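/- **Theorem (Soundness of POCKA).** Let $\mathrm{Var}$ and $\mathrm{Val}$ be finite sets. Let $\mathsf{Act}=\{(v\leftarrow n),(v\leftarrow v') \mid v,v'\in\mathrm{Var},\,n\in\mathrm{Val}\}$, let $\mathcal O$ be the set of observation terms $p,q::=\bot\mid\top\mid (v=n)\mid p\vee q\mid p\wedge q\mid\overline p$, and let $\mathcal T$ be the set of terms $e,f::=0\mid 1\mid a\in\mathsf{Act}\mid p\in\mathcal O\mid e+f\mid e\cdot f\mid e\parallel f\mid e^*$. *Semantics.* Let $\mathsf{State}$ be the set of partial functions $\mathrm{Var}\rightharpoonup\mathrm{Val}$, ordered by $\alpha\le\beta$ iff $\mathrm{dom}(\beta)\subseteq\mathrm{dom}(\alpha)$ and $\alpha,\beta$ agree on $\mathrm{dom}(\beta)$. Interpret observation terms as downwards closed subsets of $\mathsf{State}$: $[\![v=n]\!]=\{\alpha\mid\alpha(v)=n\}$, the symbols $\bot,\top,\vee,\wedge$ are $\emptyset,\mathsf{State},\cup,\cap$, and $[\![\overline p]\!]$ is the union of all downwards closed $Z\subseteq\mathsf{State}$ with $[\![p]\!]\cap Z=\emptyset$. A pomset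 over $\Sigma$ is an isomorphism class of finite posets labelled in $\Sigma$; write $1$ for the empty pomset, $\parallel$ for disjoint union and $U\cdot V$ for the disjoint union with all of $U$ placed below all of $V$. These operations are lifted elementwise to pomset languages (sets of pomsets), $L^*=\bigcup_n L^n$ with $L^0=\{1\}$ and $L^{n+1}=L^n\cdot L$, and letters are identified with one-event pomsets. Let $\Sigma=\mathsf{Act}\cup\mathsf{State}$ and define pomset languages over $\Sigma$ by $\langle\!\langle 0\rangle\!\rangle=\emptyset$, $\langle\!\langle 1\rangle\!\rangle=\{1\}$, $\langle\!\langle a\rangle\!\rangle=\mathsf{State}^*\cdot\{a\}\cdot\mathsf{State}^*$ for $a\in\mathsf{Act}$, $\langle\!\langle p\rangle\!\rangle=\mathsf{State}^*\cdot[\![p]\!]\cdot\mathsf{State}^*$ for $p\in\mathcal O$, $\langle\!\langle e+f\rangle\!\rangle=\langle\!\langle e\rangle\!\rangle\cup\langle\!\langle f\rangle\!\rangle$, and $\langle\!\langle e\cdot f\rangle\!\rangle$, $\langle\!\langle e\parallel f\rangle\!\rangle$, $\langle\!\langle e^*\rangle\!\rangle$ by the corresponding operations on languages. The POCKA semantics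 $[\![e]\!]_{\mathrm{POCKA}}$ is the smallest pomset language $M\supseteq\langle\!\langle e\rangle\!\rangle$ such that, for every hypothesis $s\le t$ below and every pomset context $C$ (a series-parallel pomset with exactly one gap, into which pomsets can be inserted), $C[\mathcal L(t)]\subseteq M$ implies $C[\mathcal L(s)]\subseteq M$. The hypotheses are $(s_1\parallel s_2)\cdot(s_3\parallel s_4)\le(s_1\cdot s_3)\parallel(s_2\cdot s_4)$ for all bi-Kleene terms $s_i$ (terms built from letters in $\Sigma$ with $0,1,+,\cdot,\parallel,{}^*$), and $\alpha\le\alpha\cdot\alpha$ for $\alpha\in\mathsf{State}$. Here $\mathcal L$ is the usual pomset language semantics of bi-Kleene terms, with $\mathcal L(c)=\{c\}$ for each letter $c\in\Sigma$. *Axioms.* Write $e\leqq f$ for $e+f\equiv f$. Let $\equiv$ be the smallest congruence on $\mathcal T$ (for all operators on terms and on observation terms) satisfying, for all $e,f,g,h\in\mathcal T$, $p,q,r\in\mathcal O$, $a\in\mathsf{Act}$, $v\in\mathrm{Var}$ and $n,m\in\mathrm{Val}$: - *Kleene algebra:* $e+(f+g)\equiv(e+f)+g$, $e+f\equiv f+e$,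 $e+0\equiv e$, $e+e\equiv e$, $e\cdot(f\cdot g)\equiv(e\cdot f)\cdot g$, $e\cdot1\equiv e\equiv1\cdot e$, $e\cdot0\equiv0\equiv0\cdot e$, $e\cdot(f+g)\equiv e\cdot f+e\cdot g$, $(e+f)\cdot g\equiv e\cdot g+f\cdot g$, $e^*\equiv1+e\cdot e^*$, $e^*\equiv1+e^*\cdot e$, $e+f\cdot g\leqq f\Rightarrow e\cdot g^*\leqq f$, $e+f\cdot g\leqq g\Rightarrow f^*\cdot e\leqq g$; - *parallel composition:* $e\parallel1\equiv e$, $e\parallel(f\parallel g)\equiv(e\parallel f)\parallel g$, $e\parallel0\equiv0$, $e\parallel(f+g)\equiv e\parallel f+e\parallel g$, $e\parallel f\equiv f\parallel e$; - *exchange:* $(e\parallel f)\cdot(g\parallel h)\leqq(e\cdot g)\parallel(f\cdot h)$; - *bounded distributive lattice:* $p\vee\bot\equiv p\equiv p\wedge\top$, commutativity and associativity of $\vee$ and $\wedge$, $p\vee(p\wedge q)\equiv p\equiv p\wedge(p\vee q)$, $p\vee(q\wedge r)\equiv(p\vee q)\wedge(p\vee r)$, $p\wedge(q\vee r)\equiv(p\wedge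 q)\vee(p\wedge r)$; - *pseudocomplement:* $p\leqq\overline q\Leftrightarrow p\wedge q\equiv\bot$; - *observations:* $(v=n)\wedge(v=m)\equiv\bot$ if $n\ne m$; $\overline{v=n}\leqq\bigvee_{m\ne n}(v=m)$; $\overline{\bigwedge_i(v_i=n_i)}\leqq\bigvee_i\overline{v_i=n_i}$ for every finite family with the $v_i$ pairwise distinct; - *interface:* $p\wedge q\leqq p\cdot q$, $p\vee q\equiv p+q$, $0\equiv\bot$, $\top\cdot p\leqq p$, $p\cdot\top\leqq p$, $\top\cdot a\leqq a$, $a\cdot\top\leqq a$. Then for all $e,f\in\mathcal T$: if $e\equiv f$, then $[\![e]\!]_{\mathrm{POCKA}}=[\![f]\!]_{\mathrm{POCKA}}$. -/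

import Mathlib

namespace POCKA

universe u v

/-! ### Labelled posets and pomsets -/

/-- A finite labelled poset over the alphabet `A`. -/
structure LPoset (A : Type u) where
  carrier : Type
  [order : PartialOrder carrier]
  [finite : Finite carrier]
  label : carrier → A

attribute [instance] LPoset.order LPoset.finite

/-- Isomorphism of labelled posets: a label-preserving order isomorphism. -/
def LPoset.Iso {A : Type u} (X Y : LPoset A) : Prop :=
  ∃ h : X.carrier ≃o Y.carrier, ∀ s, Y.label (h s) = X.label s

instance LPoset.setoid (A : Type u) : Setoid (LPoset A) where
  r := LPoset.Iso
  iseqv :=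
    { refl := fun X => ⟨OrderIso.refl X.carrier, fun _ => rfl⟩
      symm := by
        rintro X Y ⟨h, hl⟩
        refine ⟨h.symm, fun s => ?_⟩
        rw [← hl, OrderIso.apply_symm_apply]
      trans := by
        rintro X Y Z ⟨h, hl⟩ ⟨k, kl⟩
        refine ⟨h.trans k, fun s => ?_⟩
        rw [OrderIso.trans_apply, kl, hl] }

/-- Parallel composition of labelled posets: disjoint union of carriers, orders and labels. -/
def LPoset.par {A : Type u} (X Y : LPoset A) : LPoset A where
  carrier := X.carrier ⊕ Y.carrier
  label := Sum.elim X.label Y.label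

/-- Sequential composition of labelled posets: as the parallel composition, except that moreover
every event of `X` is below every event of `Y` (the lexicographic order on the disjoint sum). -/
def LPoset.seq {A : Type u} (X Y : LPoset A) : LPoset A where
  carrier := X.carrier ⊕ₗ Y.carrier
  finite := inferInstanceAs (Finite (X.carrier ⊕ Y.carrier))
  label := fun s => Sum.elim X.label Y.label (ofLex s)

theorem LPoset.par_iso {A : Type u} {X X' Y Y' : LPoset A} (hX : X ≈ X') (hY : Y ≈ Y') :
    X.par Y ≈ X'.par Y' := by
  obtain ⟨h, hl⟩ := hX
  obtain ⟨k, kl⟩ := hY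
  refine ⟨OrderIso.sumCongr h k, ?_⟩
  rintro (s | s)
  · exact hl s
  · exact kl s

theorem LPoset.seq_iso {A : Type u} {X X' Y Y' : LPoset A} (hX : X ≈ X') (hY : Y ≈ Y') :
    X.seq Y ≈ X'.seq Y' := by
  obtain ⟨h, hl⟩ := hX
  obtain ⟨k, kl⟩ := hY
  refine ⟨OrderIso.sumLexCongr h k, ?_⟩
  intro s
  rcases hs : ofLex s with t | t
  · obtain rfl : s = toLex (Sum.inl t) := hs
    exact hl t
  · obtain rfl : s = toLex (Sum.inr t) := hs
    exact kl t

/-- Pomsets over `A`: finite labelled posets up to isomorphism. -/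
def Pom (A : Type u) : Type (max u 1) := Quotient (LPoset.setoid A)

/-- The empty pomset. -/
def Pom.one {A : Type u} : Pom A :=
  Quotient.mk (LPoset.setoid A) { carrier := PEmpty, label := PEmpty.elim }

/-- The pomset with exactly one event, labelled by `a`. -/
def Pom.single {A : Type u} (a : A) : Pom A :=
  Quotient.mk (LPoset.setoid A) { carrier := PUnit, label := fun _ => a }

/-- Parallel composition of pomsets. -/
def Pom.par {A : Type u} : Pom A → Pom A → Pom A :=
  Quotient.map₂ LPoset.par (fun _ _ hX _ _ hY => LPoset.par_iso hX hY)

/-- Sequential composition of pomsets. -/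
def Pom.seq {A : Type u} : Pom A → Pom A → Pom A :=
  Quotient.map₂ LPoset.seq (fun _ _ hX _ _ hY => LPoset.seq_iso hX hY)

/-- Series-parallel pomsets. -/
inductive IsSP {A : Type u} : Pom A → Prop
  | one : IsSP Pom.one
  | single (a : A) : IsSP (Pom.single a)
  | seq {U V : Pom A} : IsSP U → IsSP V → IsSP (U.seq V)
  | par {U V : Pom A} : IsSP U → IsSP V → IsSP (U.par V)

/-- Pomset contexts: series-parallel pomsets with exactly one gap, presented by the way in which
they are built up around the gap. -/
inductive PomCtx (A : Type u) : Type (max u 1)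
  | hole : PomCtx A
  | seqLeft (X : Pom A) (hX : IsSP X) (C : PomCtx A) : PomCtx A
  | seqRight (C : PomCtx A) (X : Pom A) (hX : IsSP X) : PomCtx A
  | par (X : Pom A) (hX : IsSP X) (C : PomCtx A) : PomCtx A

/-- `C.fill U` is `C[U]`, the pomset obtained by inserting `U` into the gap of `C`. -/
def PomCtx.fill {A : Type u} : PomCtx A → Pom A → Pom A
  | .hole, U => U
  | .seqLeft X _ C, U => X.seq (C.fill U)
  | .seqRight C X _, U => (C.fill U).seq X
  | .par X _ C, U => X.par (C.fill U)

/-! ### Pomset languages -/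

/-- Pomset languages. -/
abbrev Lang (A : Type u) : Type (max u 1) := Set (Pom A)

def Lang.seq {A : Type u} (L K : Lang A) : Lang A := Set.image2 Pom.seq L K

def Lang.par {A : Type u} (L K : Lang A) : Lang A := Set.image2 Pom.par L K

def Lang.pow {A : Type u} (L : Lang A) : ℕ → Lang A
  | 0 => {Pom.one}
  | n + 1 => Lang.seq (Lang.pow L n) L

def Lang.star {A : Type u} (L : Lang A) : Lang A := ⋃ n : ℕ, Lang.pow L n

/-! ### Bi-Kleene algebra terms, their semantics, and closure under hypotheses -/

/-- Terms of bi-Kleene algebra over the alphabet `A`. -/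
inductive BKATerm (A : Type u) : Type u
  | zero : BKATerm A
  | one : BKATerm A
  | letter (a : A) : BKATerm A
  | add (e f : BKATerm A) : BKATerm A
  | seq (e f : BKATerm A) : BKATerm A
  | par (e f : BKATerm A) : BKATerm A
  | star (e : BKATerm A) : BKATerm A

infixl:65 " +ₜ " => BKATerm.add
infixl:70 " ⬝ₜ " => BKATerm.seq
infixl:67 " ∥ₜ " => BKATerm.par
postfix:max "⋆ₜ" => BKATerm.star

/-- The pomset language semantics of bi-Kleene algebra terms. -/
def bkaSem {A : Type u} : BKATerm A → Lang A
  | .zero => ∅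
  | .one => {Pom.one}
  | .letter a => {Pom.single a}
  | .add e f => bkaSem e ∪ bkaSem f
  | .seq e f => Lang.seq (bkaSem e) (bkaSem f)
  | .par e f => Lang.par (bkaSem e) (bkaSem f)
  | .star e => Lang.star (bkaSem e)

/-- A hypothesis `e ≤ f` between bi-Kleene algebra terms is represented by the pair `(e, f)`. -/
abbrev Hyp (A : Type u) : Type u := BKATerm A × BKATerm A

/-- Membership in the `H`-closure of `L`, the smallest language `M` containing `L` such that
`C[⟦e⟧] ⊆ M` whenever `e ≤ f` is in `H`, `C` is a pomset context and `C[⟦f⟧] ⊆ M`. -/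
inductive InClosure {A : Type u} (H : Set (Hyp A)) (L : Lang A) : Pom A → Prop
  | base {U : Pom A} : U ∈ L → InClosure H L U
  | step {e f : BKATerm A} (C : PomCtx A) : (e, f) ∈ H →
      (∀ V, V ∈ bkaSem f → InClosure H L (C.fill V)) →
      ∀ U, U ∈ bkaSem e → InClosure H L (C.fill U)

/-- The `H`-closure of the pomset language `L`. -/
def closure {A : Type u} (H : Set (Hyp A)) (L : Lang A) : Lang A := {U | InClosure H L U}

/-- The hypotheses of the exchange law. -/
def exch (A : Type u) : Set (Hyp A) :=
  {h | ∃ e f g k : BKATerm A,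
    h = ((e ∥ₜ f) ⬝ₜ (g ∥ₜ k), (e ⬝ₜ g) ∥ₜ (f ⬝ₜ k))}

/-! ### Actions, states and observations -/

/-- Actions: assignments `v ← n` of a value, and assignments `v ← w` of a variable. -/
inductive Act (Var : Type u) (Val : Type v) : Type (max u v)
  | assign (x : Var) (n : Val) : Act Var Val
  | copy (x y : Var) : Act Var Val

/-- States: partial functions from variables to values. -/
@[ext] structure State (Var : Type u) (Val : Type v) : Type (max u v) where
  val : Var → Option Val

/-- The domain of a state. -/
def State.dom {Var : Type u} {Val : Type v} (α : State Var Val) : Set Var :=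
  {x | (α.val x).isSome}

/-- `α ≤ β` iff `dom β ⊆ dom α` and `α` agrees with `β` on `dom β`. -/
instance {Var : Type u} {Val : Type v} : PartialOrder (State Var Val) where
  le α β := β.dom ⊆ α.dom ∧ ∀ x ∈ β.dom, α.val x = β.val x
  le_refl α := ⟨subset_rfl, fun _ _ => rfl⟩
  le_trans α β γ h₁ h₂ :=
    ⟨h₂.1.trans h₁.1, fun x hx => (h₁.2 x (h₂.1 hx)).trans (h₂.2 x hx)⟩
  le_antisymm α β h₁ h₂ := by
    ext1
    funext x
    by_cases hx : x ∈ β.dom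
    · exact h₁.2 x hx
    · have hx' : x ∉ α.dom := fun h => hx (h₂.1 h)
      simp only [State.dom, Set.mem_ofPred_eq, Option.not_isSome_iff_eq_none] at hx hx'
      rw [hx, hx']

/-- Observation terms: the term language of pseudocomplemented distributive lattices over the
atomic observations `x = n`. -/
inductive Obs (Var : Type u) (Val : Type v) : Type (max u v)
  | bot : Obs Var Val
  | top : Obs Var Val
  | eq (x : Var) (n : Val) : Obs Var Val
  | or (p q : Obs Var Val) : Obs Var Val
  | and (p q : Obs Var Val) : Obs Var Val
  | neg (p : Obs Var Val) : Obs Var Val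

infixl:65 " ∨ₒ " => Obs.or
infixl:70 " ∧ₒ " => Obs.and
prefix:max "¬ₒ" => Obs.neg

/-- The join of a finite list of observation terms (`⊥` for the empty list). -/
def Obs.bigOr {Var : Type u} {Val : Type v} (l : List (Obs Var Val)) : Obs Var Val :=
  l.foldr Obs.or Obs.bot

/-- The meet of a finite list of observation terms (`⊤` for the empty list). -/
def Obs.bigAnd {Var : Type u} {Val : Type v} (l : List (Obs Var Val)) : Obs Var Val :=
  l.foldr Obs.and Obs.top

/-- The observation algebra is the lattice `LowerSet (State Var Val)` of downwards closed sets of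
states, under intersection and union.  This is its element `{α | α(x) = n}`. -/
def oaAtom {Var : Type u} {Val : Type v} (x : Var) (n : Val) : LowerSet (State Var Val) where
  carrier := {α | α.val x = some n}
  lower' := by
    intro α β hβα hα
    have hx : x ∈ α.dom := by
      simp only [State.dom, Set.mem_ofPred_eq] at hα ⊢
      rw [hα]; rfl
    exact (hβα.2 x hx).trans hα

/-- The pseudocomplement of the observation algebra: the union of all downwards closed sets
disjoint from `Y`. -/
def oaNeg {Var : Type u} {Val : Type v} (Y : LowerSet (State Var Val)) :
    LowerSet (State Var Val) :=
  sSup {Z | Y ⊓ Z = ⊥}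

/-- Interpretation of observation terms in the observation algebra. -/
def oaSem {Var : Type u} {Val : Type v} : Obs Var Val → LowerSet (State Var Val)
  | .bot => ⊥
  | .top => ⊤
  | .eq x n => oaAtom x n
  | .or p q => oaSem p ⊔ oaSem q
  | .and p q => oaSem p ⊓ oaSem q
  | .neg p => oaNeg (oaSem p)

/-! ### POCKA terms and their semantics -/

/-- POCKA terms: bi-Kleene algebra terms over actions and observation terms. -/
abbrev Term (Var : Type u) (Val : Type v) : Type (max u v) :=
  BKATerm (Act Var Val ⊕ Obs Var Val)

/-- An action as a POCKA term. -/
abbrev Term.act {Var : Type u} {Val : Type v} (a : Act Var Val) : Term Var Val :=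
  BKATerm.letter (Sum.inl a)

/-- An observation term as a POCKA term. -/
abbrev Term.obs {Var : Type u} {Val : Type v} (p : Obs Var Val) : Term Var Val :=
  BKATerm.letter (Sum.inr p)

/-- The alphabet of the pomsets in the semantics: actions and states. -/
abbrev Letter (Var : Type u) (Val : Type v) : Type (max u v) := Act Var Val ⊕ State Var Val

/-- The language of one-event pomsets labelled by a state in `S`. -/
def stateLang {Var : Type u} {Val : Type v} (S : Set (State Var Val)) : Lang (Letter Var Val) :=
  {U | ∃ α ∈ S, U = Pom.single (Sum.inr α)}

/-- `State* · L · State*`. -/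
def surround {Var : Type u} {Val : Type v} (L : Lang (Letter Var Val)) :
    Lang (Letter Var Val) :=
  Lang.seq (Lang.seq (Lang.star (stateLang Set.univ)) L) (Lang.star (stateLang Set.univ))

/-- The unclosed semantics of POCKA terms. -/
def rawSem {Var : Type u} {Val : Type v} : Term Var Val → Lang (Letter Var Val)
  | .zero => ∅
  | .one => {Pom.one}
  | .letter (.inl a) => surround {Pom.single (Sum.inl a)}
  | .letter (.inr p) => surround (stateLang (oaSem p : Set (State Var Val)))
  | .add e f => rawSem e ∪ rawSem f
  | .seq e f => Lang.seq (rawSem e) (rawSem f)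
  | .par e f => Lang.par (rawSem e) (rawSem f)
  | .star e => Lang.star (rawSem e)

/-- The contraction hypotheses `α ≤ α · α`, for `α` a state. -/
def contr (Var : Type u) (Val : Type v) : Set (Hyp (Letter Var Val)) :=
  {h | ∃ α : State Var Val, h = (BKATerm.letter (Sum.inr α),
    BKATerm.letter (Sum.inr α) ⬝ₜ BKATerm.letter (Sum.inr α))}

/-- The POCKA semantics of a term. -/
def pockaSem {Var : Type u} {Val : Type v} (e : Term Var Val) : Lang (Letter Var Val) :=
  closure (exch (Letter Var Val) ∪ contr Var Val) (rawSem e)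

/-! ### Derivability from the POCKA axioms -/

open BKATerm Obs in
/-- Provable equivalence of POCKA terms: the smallest congruence (with respect to the operators on
terms and to those on observation terms) generated by the POCKA axioms.  An inequation `e ≤ f`
abbreviates `e + f ≡ f`. -/
inductive ProvEquiv {Var : Type u} {Val : Type v} : Term Var Val → Term Var Val → Prop
  -- equivalence relation
  | refl (e) : ProvEquiv e e
  | symm {e f} : ProvEquiv e f → ProvEquiv f e
  | trans {e f g} : ProvEquiv e f → ProvEquiv f g → ProvEquiv e g
  -- congruence for the operators on terms
  | add_congr {e e' f f'} : ProvEquiv e e' → ProvEquiv f f' → ProvEquiv (e +ₜ f) (e' +ₜ f')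
  | seq_congr {e e' f f'} : ProvEquiv e e' → ProvEquiv f f' → ProvEquiv (e ⬝ₜ f) (e' ⬝ₜ f')
  | par_congr {e e' f f'} : ProvEquiv e e' → ProvEquiv f f' → ProvEquiv (e ∥ₜ f) (e' ∥ₜ f')
  | star_congr {e e'} : ProvEquiv e e' → ProvEquiv e⋆ₜ e'⋆ₜ
  -- congruence for the operators on observation terms
  | or_congr {p p' q q'} : ProvEquiv (Term.obs p) (Term.obs p') → ProvEquiv (Term.obs q) (Term.obs q') →
      ProvEquiv (Term.obs (p ∨ₒ q)) (Term.obs (p' ∨ₒ q'))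
  | and_congr {p p' q q'} : ProvEquiv (Term.obs p) (Term.obs p') → ProvEquiv (Term.obs q) (Term.obs q') →
      ProvEquiv (Term.obs (p ∧ₒ q)) (Term.obs (p' ∧ₒ q'))
  | neg_congr {p p'} : ProvEquiv (Term.obs p) (Term.obs p') → ProvEquiv (Term.obs (¬ₒp)) (Term.obs (¬ₒp'))
  -- Kleene algebra axioms
  | add_assoc (e f g) : ProvEquiv (e +ₜ (f +ₜ g)) ((e +ₜ f) +ₜ g)
  | add_comm (e f) : ProvEquiv (e +ₜ f) (f +ₜ e)
  | add_zero (e) : ProvEquiv (e +ₜ zero) e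
  | add_idem (e) : ProvEquiv (e +ₜ e) e
  | seq_assoc (e f g) : ProvEquiv (e ⬝ₜ (f ⬝ₜ g)) ((e ⬝ₜ f) ⬝ₜ g)
  | seq_one (e) : ProvEquiv (e ⬝ₜ one) e
  | one_seq (e) : ProvEquiv (one ⬝ₜ e) e
  | seq_zero (e) : ProvEquiv (e ⬝ₜ zero) zero
  | zero_seq (e) : ProvEquiv (zero ⬝ₜ e) zero
  | seq_add (e f g) : ProvEquiv (e ⬝ₜ (f +ₜ g)) (e ⬝ₜ f +ₜ e ⬝ₜ g)
  | add_seq (e f g) : ProvEquiv ((e +ₜ f) ⬝ₜ g) (e ⬝ₜ g +ₜ f ⬝ₜ g)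
  | star_unfold_left (e) : ProvEquiv e⋆ₜ (one +ₜ e ⬝ₜ e⋆ₜ)
  | star_unfold_right (e) : ProvEquiv e⋆ₜ (one +ₜ e⋆ₜ ⬝ₜ e)
  | star_induct_right {e f g} : ProvEquiv ((e +ₜ f ⬝ₜ g) +ₜ f) f → ProvEquiv (e ⬝ₜ g⋆ₜ +ₜ f) f
  | star_induct_left {e f g} : ProvEquiv ((e +ₜ f ⬝ₜ g) +ₜ g) g → ProvEquiv (f⋆ₜ ⬝ₜ e +ₜ g) g
  -- additional bi-Kleene algebra axioms
  | par_one (e) : ProvEquiv (e ∥ₜ one) e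
  | par_assoc (e f g) : ProvEquiv (e ∥ₜ (f ∥ₜ g)) ((e ∥ₜ f) ∥ₜ g)
  | par_zero (e) : ProvEquiv (e ∥ₜ zero) zero
  | par_add (e f g) : ProvEquiv (e ∥ₜ (f +ₜ g)) ((e ∥ₜ f) +ₜ (e ∥ₜ g))
  | par_comm (e f) : ProvEquiv (e ∥ₜ f) (f ∥ₜ e)
  -- exchange law
  | exchange (e f g h) :
      ProvEquiv (((e ∥ₜ f) ⬝ₜ (g ∥ₜ h)) +ₜ ((e ⬝ₜ g) ∥ₜ (f ⬝ₜ h))) ((e ⬝ₜ g) ∥ₜ (f ⬝ₜ h))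
  -- bounded distributive lattice axioms
  | or_bot (p) : ProvEquiv (Term.obs (p ∨ₒ bot)) (Term.obs p)
  | and_top (p) : ProvEquiv (Term.obs (p ∧ₒ top)) (Term.obs p)
  | or_comm (p q) : ProvEquiv (Term.obs (p ∨ₒ q)) (Term.obs (q ∨ₒ p))
  | and_comm (p q) : ProvEquiv (Term.obs (p ∧ₒ q)) (Term.obs (q ∧ₒ p))
  | and_assoc (p q r) : ProvEquiv (Term.obs (p ∧ₒ (q ∧ₒ r))) (Term.obs ((p ∧ₒ q) ∧ₒ r))
  | or_assoc (p q r) : ProvEquiv (Term.obs (p ∨ₒ (q ∨ₒ r))) (Term.obs ((p ∨ₒ q) ∨ₒ r))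
  | or_absorb (p q) : ProvEquiv (Term.obs (p ∨ₒ (p ∧ₒ q))) (Term.obs p)
  | and_absorb (p q) : ProvEquiv (Term.obs (p ∧ₒ (p ∨ₒ q))) (Term.obs p)
  | or_and (p q r) : ProvEquiv (Term.obs (p ∨ₒ (q ∧ₒ r))) (Term.obs ((p ∨ₒ q) ∧ₒ (p ∨ₒ r)))
  | and_or (p q r) : ProvEquiv (Term.obs (p ∧ₒ (q ∨ₒ r))) (Term.obs ((p ∧ₒ q) ∨ₒ (p ∧ₒ r)))
  -- pseudocomplement: `p ≤ ¬q` if and only if `p ∧ q ≡ ⊥`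
  | neg_elim {p q} : ProvEquiv (Term.obs p +ₜ Term.obs (¬ₒq)) (Term.obs (¬ₒq)) →
      ProvEquiv (Term.obs (p ∧ₒ q)) (Term.obs bot)
  | neg_intro {p q} : ProvEquiv (Term.obs (p ∧ₒ q)) (Term.obs bot) →
      ProvEquiv (Term.obs p +ₜ Term.obs (¬ₒq)) (Term.obs (¬ₒq))
  -- observation axioms
  | eq_and_eq (x : Var) {n m : Val} : n ≠ m → ProvEquiv (Term.obs (eq x n ∧ₒ eq x m)) (Term.obs bot)
  -- here `l` lists the values different from `n`
  | neg_eq (x : Var) (n : Val) (l : List Val) : (∀ m, m ∈ l ↔ m ≠ n) →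
      ProvEquiv (Term.obs (¬ₒ(eq x n)) +ₜ Term.obs (bigOr (l.map fun m => eq x m)))
        (Term.obs (bigOr (l.map fun m => eq x m)))
  -- here `l` is a finite list of pairs `(xᵢ, nᵢ)` in which the `xᵢ` are distinct
  | neg_and (l : List (Var × Val)) : (l.map Prod.fst).Nodup →
      ProvEquiv (Term.obs (¬ₒ(bigAnd (l.map fun a => eq a.1 a.2))) +ₜ
          Term.obs (bigOr (l.map fun a => ¬ₒ(eq a.1 a.2))))
        (Term.obs (bigOr (l.map fun a => ¬ₒ(eq a.1 a.2))))
  -- interface axioms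
  | and_le_seq (p q) : ProvEquiv (Term.obs (p ∧ₒ q) +ₜ (Term.obs p ⬝ₜ Term.obs q)) (Term.obs p ⬝ₜ Term.obs q)
  | or_eq_add (p q) : ProvEquiv (Term.obs (p ∨ₒ q)) (Term.obs p +ₜ Term.obs q)
  | zero_eq_bot : ProvEquiv zero (Term.obs bot)
  | top_seq_obs (p) : ProvEquiv ((Term.obs top ⬝ₜ Term.obs p) +ₜ Term.obs p) (Term.obs p)
  | obs_seq_top (p) : ProvEquiv ((Term.obs p ⬝ₜ Term.obs top) +ₜ Term.obs p) (Term.obs p)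
  | top_seq_act (a) : ProvEquiv ((Term.obs top ⬝ₜ Term.act a) +ₜ Term.act a) (Term.act a)
  | act_seq_top (a) : ProvEquiv ((Term.act a ⬝ₜ Term.obs top) +ₜ Term.act a) (Term.act a)

end POCKA

namespace POCKA

universe u v

/-! ### Algebra of pomsets -/

namespace Pom

variable {A : Type u}

/-! The proof is by induction on the derivation of `e ≡ f`. The equational Kleene and parallel
axioms already hold for the unclosed semantics, because they are laws of pomsets lifted to
languages. An axiom `e ≦ f` amounts to `rawSem e ⊆ closure H (rawSem f)`: closure is monotone and
idempotent, so only unclosed pomsets on the left need checking.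

The congruence rules and the two star induction rules have premises about closed languages, so
closure must be compatible with the operators: `closure_seq_closure_subset` and
`closure_par_closure_subset` give `closure L · closure K ⊆ closure (L · K)` and its parallel
analogue, by absorbing the other factor into the context. Contexts contain only series-parallel
pomsets, hence the bookkeeping with `IsSP`.

For observations the premises must be turned back into statements about downwards closed sets of
states. A closure step changes the shape of a pomset but not its set of labels, so every pomset in
the closure of `State* · S · State*` still carries a label from `S`. Applied to one-event pomsets,
this gives `rawSem_obs_subset_closure_iff`: closed inclusion of observations is inclusion of their
sets of states. The lattice, pseudocomplement and observation axioms then become facts about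
downwards closed sets. Of the interface axioms, `p ∧ q ≦ p · q` uses contraction, and those for `⊤`
hold because `State*` absorbs further states. -/

theorem seq_assoc (U V W : Pom A) : (U.seq V).seq W = U.seq (V.seq W) := by
  induction U using Quotient.inductionOn with | _ X
  induction V using Quotient.inductionOn with | _ Y
  induction W using Quotient.inductionOn with | _ Z
  refine Quotient.sound ⟨OrderIso.sumLexAssoc X.carrier Y.carrier Z.carrier, ?_⟩
  rintro ((s | s) | s) <;> rfl

theorem par_assoc (U V W : Pom A) : (U.par V).par W = U.par (V.par W) := by
  induction U using Quotient.inductionOn with | _ X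
  induction V using Quotient.inductionOn with | _ Y
  induction W using Quotient.inductionOn with | _ Z
  refine Quotient.sound ⟨OrderIso.sumAssoc X.carrier Y.carrier Z.carrier, ?_⟩
  rintro ((s | s) | s) <;> rfl

theorem par_comm (U V : Pom A) : U.par V = V.par U := by
  induction U using Quotient.inductionOn with | _ X
  induction V using Quotient.inductionOn with | _ Y
  refine Quotient.sound ⟨OrderIso.sumComm X.carrier Y.carrier, ?_⟩
  rintro (s | s) <;> rfl

theorem seq_one (U : Pom A) : U.seq one = U := by
  induction U using Quotient.inductionOn with | _ X
  refine Quotient.sound ⟨OrderIso.sumLexEmpty (α := X.carrier) (β := PEmpty), ?_⟩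
  rintro (s | s)
  · rfl
  · exact s.elim

theorem one_seq (U : Pom A) : one.seq U = U := by
  induction U using Quotient.inductionOn with | _ X
  refine Quotient.sound ⟨OrderIso.emptySumLex (α := X.carrier) (β := PEmpty), ?_⟩
  rintro (s | s)
  · exact s.elim
  · rfl

theorem par_one (U : Pom A) : U.par one = U := by
  induction U using Quotient.inductionOn with | _ X
  refine Quotient.sound ⟨OrderIso.symm ⟨(Equiv.sumEmpty X.carrier PEmpty).symm, ?_⟩, ?_⟩
  · intro a b
    exact Sum.inl_le_inl_iff
  · rintro (s | s)
    · rfl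
    · exact s.elim

/-- The set of labels occurring in a pomset. -/
def labels : Pom A → Set A :=
  Quotient.lift (fun X => Set.range X.label) <| by
    rintro X Y ⟨h, hl⟩
    have : X.label = Y.label ∘ h := funext fun s => (hl s).symm
    simp only [this, h.surjective.range_comp]

theorem labels_single (a : A) : (single a).labels = {a} :=
  Set.range_const (ι := PUnit)

theorem labels_seq (U V : Pom A) : (U.seq V).labels = U.labels ∪ V.labels := by
  induction U using Quotient.inductionOn with | _ X
  induction V using Quotient.inductionOn with | _ Y
  exact Set.Sum.elim_range X.label Y.label

theorem labels_par (U V : Pom A) : (U.par V).labels = U.labels ∪ V.labels := by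
  induction U using Quotient.inductionOn with | _ X
  induction V using Quotient.inductionOn with | _ Y
  exact Set.Sum.elim_range X.label Y.label

end Pom

theorem PomCtx.labels_fill {A : Type u} (C : PomCtx A) {U V : Pom A} (h : U.labels = V.labels) :
    (C.fill U).labels = (C.fill V).labels := by
  induction C with
  | hole => exact h
  | seqLeft X hX C ih => simp only [fill, Pom.labels_seq, ih]
  | seqRight C X hX ih => simp only [fill, Pom.labels_seq, ih]
  | par X hX C ih => simp only [fill, Pom.labels_par, ih]

theorem PomCtx.isSP_fill {A : Type u} (C : PomCtx A) {U : Pom A} (h : IsSP U) :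
    IsSP (C.fill U) := by
  induction C with
  | hole => exact h
  | seqLeft X hX C ih => exact hX.seq ih
  | seqRight C X hX ih => exact ih.seq hX
  | par X hX C ih => exact hX.par ih

/-! ### Algebra of pomset languages -/

/-- Languages of series-parallel pomsets. -/
def Lang.IsSP {A : Type u} (L : Lang A) : Prop := ∀ U ∈ L, POCKA.IsSP U

namespace Lang

variable {A : Type u} {L L' K K' : Lang A}

theorem seq_assoc (L K M : Lang A) : (L.seq K).seq M = L.seq (K.seq M) :=
  Set.image2_assoc Pom.seq_assoc

theorem seq_mono (hL : L ⊆ L') (hK : K ⊆ K') : L.seq K ⊆ L'.seq K' :=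
  Set.image2_subset hL hK

theorem par_mono (hL : L ⊆ L') (hK : K ⊆ K') : L.par K ⊆ L'.par K' :=
  Set.image2_subset hL hK

theorem seq_one (L : Lang A) : L.seq {Pom.one} = L := by
  simp [seq, Pom.seq_one]

theorem one_seq (L : Lang A) : Lang.seq {Pom.one} L = L := by
  simp [seq, Pom.one_seq]

/-- Powers are defined with the new factor on the right; the left unfolding and left induction rules
for star need it on the left. -/
theorem pow_succ_left (L : Lang A) (n : ℕ) : L.pow (n + 1) = L.seq (L.pow n) := by
  induction n with
  | zero => simp only [pow, one_seq, seq_one]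
  | succ n ih => rw [pow, ih, seq_assoc, ← ih, pow]

theorem pow_add (L : Lang A) (m n : ℕ) : L.pow (m + n) = (L.pow m).seq (L.pow n) := by
  induction n with
  | zero => simp only [pow, seq_one, Nat.add_zero]
  | succ n ih => rw [← Nat.add_assoc, pow, ih, seq_assoc, ← pow]

theorem pow_subset_star (L : Lang A) (n : ℕ) : L.pow n ⊆ L.star :=
  Set.subset_iUnion L.pow n

theorem one_subset_star (L : Lang A) : {Pom.one} ⊆ L.star :=
  L.pow_subset_star 0

theorem subset_star (L : Lang A) : L ⊆ L.star := by
  simpa only [pow, one_seq] using L.pow_subset_star 1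

theorem seq_iUnion {ι : Sort*} (L : Lang A) (K : ι → Lang A) :
    L.seq (⋃ i, K i) = ⋃ i, L.seq (K i) :=
  Set.image2_iUnion_right _ _ _

theorem iUnion_seq {ι : Sort*} (L : ι → Lang A) (K : Lang A) :
    Lang.seq (⋃ i, L i) K = ⋃ i, (L i).seq K :=
  Set.image2_iUnion_left _ _ _

theorem star_seq_star_subset (L : Lang A) : L.star.seq L.star ⊆ L.star := by
  rintro _ ⟨U, hU, V, hV, rfl⟩
  obtain ⟨m, hm⟩ := Set.mem_iUnion.1 hU
  obtain ⟨n, hn⟩ := Set.mem_iUnion.1 hV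
  exact L.pow_subset_star (m + n) (L.pow_add m n ▸ Set.mem_image2_of_mem hm hn)

theorem star_unfold_right (L : Lang A) : L.star = {Pom.one} ∪ L.star.seq L := by
  rw [star, iUnion_seq]
  exact (sup_iSup_nat_succ L.pow).symm

theorem star_unfold_left (L : Lang A) : L.star = {Pom.one} ∪ L.seq L.star := by
  rw [star, seq_iUnion]
  simp only [← pow_succ_left]
  exact (sup_iSup_nat_succ L.pow).symm

theorem IsSP.seq (hL : L.IsSP) (hK : K.IsSP) : (L.seq K).IsSP := by
  rintro _ ⟨U, hU, V, hV, rfl⟩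
  exact (hL U hU).seq (hK V hV)

theorem IsSP.par (hL : L.IsSP) (hK : K.IsSP) : (L.par K).IsSP := by
  rintro _ ⟨U, hU, V, hV, rfl⟩
  exact (hL U hU).par (hK V hV)

theorem IsSP.one : Lang.IsSP ({Pom.one} : Lang A) := by
  rintro _ rfl
  exact .one

theorem IsSP.single (a : A) : Lang.IsSP ({Pom.single a} : Lang A) := by
  rintro _ rfl
  exact .single a

theorem IsSP.union (hL : L.IsSP) (hK : K.IsSP) : Lang.IsSP (L ∪ K) := by
  rintro U (hU | hU)
  · exact hL U hU
  · exact hK U hU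

theorem IsSP.pow (hL : L.IsSP) (n : ℕ) : (L.pow n).IsSP := by
  induction n with
  | zero => exact .one
  | succ n ih => exact ih.seq hL

theorem IsSP.star (hL : L.IsSP) : L.star.IsSP := by
  intro U hU
  obtain ⟨n, hn⟩ := Set.mem_iUnion.1 hU
  exact hL.pow n U hn

end Lang

theorem isSP_bkaSem {A : Type u} (e : BKATerm A) : (bkaSem e).IsSP := by
  induction e with
  | zero => exact fun _ h => h.elim
  | one => exact .one
  | letter a => exact .single a
  | add e f he hf => exact he.union hf
  | seq e f he hf => exact he.seq hf
  | par e f he hf => exact he.par hf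
  | star e he => exact he.star

/-- The exchange hypotheses range over terms; this allows them to be applied to individual
series-parallel pomsets. -/
theorem IsSP.exists_bkaSem_eq_singleton {A : Type u} {U : Pom A} (h : IsSP U) :
    ∃ e : BKATerm A, bkaSem e = {U} := by
  induction h with
  | one => exact ⟨.one, rfl⟩
  | single a => exact ⟨.letter a, rfl⟩
  | seq _ _ ihU ihV =>
    obtain ⟨e, he⟩ := ihU
    obtain ⟨f, hf⟩ := ihV
    exact ⟨.seq e f, by simp only [bkaSem, he, hf, Lang.seq, Set.image2_singleton]⟩
  | par _ _ ihU ihV =>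
    obtain ⟨e, he⟩ := ihU
    obtain ⟨f, hf⟩ := ihV
    exact ⟨.par e f, by simp only [bkaSem, he, hf, Lang.par, Set.image2_singleton]⟩

/-! ### Closure under hypotheses -/

section Closure

variable {A : Type u} {H : Set (Hyp A)} {L L' K K' : Lang A}

theorem subset_closure : L ⊆ closure H L := fun _ h => .base h

/-- Idempotence in usable form: the steps deriving a pomset from `L` can be replayed on top of those
deriving `L` from `K`. -/
theorem closure_subset_of_subset_closure (h : L ⊆ closure H K) : closure H L ⊆ closure H K := by
  intro U hU
  induction hU with
  | base hU => exact h hU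
  | step C hef _ U hU ih => exact InClosure.step C hef ih U hU

theorem closure_mono (h : L ⊆ K) : closure H L ⊆ closure H K :=
  closure_subset_of_subset_closure (h.trans subset_closure)

/-- Translates the encoding of `e ≦ f` as `e + f ≡ f` into an inclusion with an unclosed left side.
-/
theorem closure_union_eq_right_iff : closure H (L ∪ K) = closure H K ↔ L ⊆ closure H K := by
  constructor
  · intro h
    rw [← h]
    exact Set.subset_union_left.trans subset_closure
  · intro h
    exact (closure_subset_of_subset_closure (Set.union_subset h subset_closure)).antisymm
      (closure_mono Set.subset_union_right)

theorem Lang.IsSP.closure (hL : L.IsSP) : Lang.IsSP (closure H L) := by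
  intro U hU
  induction hU with
  | base hU => exact hL _ hU
  | step C _ _ U hU _ => exact C.isSP_fill (isSP_bkaSem _ U hU)

/-- A step in context `C` on one factor is a step on the product, in the context `C` extended by the
other factor. That factor must be series-parallel to be part of a context, which is why closure has
to preserve `IsSP`. -/
theorem closure_seq_closure_subset (hL : L.IsSP) (hK : K.IsSP) :
    (closure H L).seq (closure H K) ⊆ closure H (L.seq K) := by
  rintro _ ⟨U, hU, V, hV, rfl⟩
  have hVsp : IsSP V := hK.closure V hV
  induction hU with
  | base hU =>
    induction hV with
    | base hV => exact .base (Set.mem_image2_of_mem hU hV)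
    | step C hef _ V hV ih =>
      -- As `hVsp` mentions the index of `hV`, it has become a premise of `ih`.
      exact InClosure.step (.seqLeft _ (hL _ hU) C) hef
        (fun W hW => ih W hW (C.isSP_fill (isSP_bkaSem _ W hW))) V hV
  | step C hef _ U hU ih => exact InClosure.step (.seqRight C V hVsp) hef ih U hU

theorem closure_par_closure_subset (hL : L.IsSP) (hK : K.IsSP) :
    (closure H L).par (closure H K) ⊆ closure H (L.par K) := by
  rintro _ ⟨U, hU, V, hV, rfl⟩
  have hVsp : IsSP V := hK.closure V hV
  induction hU with
  | base hU =>
    induction hV with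
    | base hV => exact .base (Set.mem_image2_of_mem hU hV)
    | step C hef _ V hV ih =>
      exact InClosure.step (.par _ (hL _ hU) C) hef
        (fun W hW => ih W hW (C.isSP_fill (isSP_bkaSem _ W hW))) V hV
  | step C hef _ U hU ih =>
    -- Parallel contexts have their gap on the right only, so the factors are swapped and swapped
    -- back.
    rw [Pom.par_comm]
    refine InClosure.step (.par V hVsp C) hef (fun W hW => ?_) U hU
    rw [PomCtx.fill, Pom.par_comm]
    exact ih W hW

theorem seq_subset_closure_seq (hL' : L'.IsSP) (hK' : K'.IsSP) (h : L ⊆ closure H L')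
    (k : K ⊆ closure H K') : L.seq K ⊆ closure H (L'.seq K') :=
  (Lang.seq_mono h k).trans (closure_seq_closure_subset hL' hK')

theorem par_subset_closure_par (hL' : L'.IsSP) (hK' : K'.IsSP) (h : L ⊆ closure H L')
    (k : K ⊆ closure H K') : L.par K ⊆ closure H (L'.par K') :=
  (Lang.par_mono h k).trans (closure_par_closure_subset hL' hK')

theorem star_subset_closure_star (hL' : L'.IsSP) (h : L ⊆ closure H L') :
    L.star ⊆ closure H L'.star := by
  refine Set.iUnion_subset fun n => Set.Subset.trans ?_ (closure_mono (L'.pow_subset_star n))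
  induction n with
  | zero => exact subset_closure
  | succ n ih => exact seq_subset_closure_seq (hL'.pow n) hL' ih h

/-- By induction `L' · Kⁿ ⊆ closure L`; one more factor gives `closure L · K ⊆ closure (L · K) ⊆
closure L`. -/
theorem seq_star_subset_closure (hL : L.IsSP) (hK : K.IsSP) (h : L' ⊆ closure H L)
    (k : L.seq K ⊆ closure H L) : L'.seq K.star ⊆ closure H L := by
  rw [Lang.star, Lang.seq_iUnion]
  refine Set.iUnion_subset fun n => ?_
  induction n with
  | zero => rwa [Lang.pow, Lang.seq_one]
  | succ n ih =>
    rw [Lang.pow, ← Lang.seq_assoc]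
    exact (seq_subset_closure_seq hL hK ih subset_closure).trans
      (closure_subset_of_subset_closure k)

theorem star_seq_subset_closure (hL : L.IsSP) (hK : K.IsSP) (h : L' ⊆ closure H L)
    (k : K.seq L ⊆ closure H L) : K.star.seq L' ⊆ closure H L := by
  rw [Lang.star, Lang.iUnion_seq]
  refine Set.iUnion_subset fun n => ?_
  induction n with
  | zero => rwa [Lang.pow, Lang.one_seq]
  | succ n ih =>
    rw [Lang.pow_succ_left, Lang.seq_assoc]
    exact (seq_subset_closure_seq hK hL subset_closure ih).trans
      (closure_subset_of_subset_closure k)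

theorem exchange_subset_closure (hH : exch A ⊆ H) (hL : L.IsSP) (hL' : L'.IsSP) (hK : K.IsSP)
    (hK' : K'.IsSP) :
    (L.par L').seq (K.par K') ⊆ closure H ((L.seq K).par (L'.seq K')) := by
  rintro _ ⟨_, ⟨U, hU, U', hU', rfl⟩, _, ⟨V, hV, V', hV', rfl⟩, rfl⟩
  obtain ⟨e, he⟩ := (hL U hU).exists_bkaSem_eq_singleton
  obtain ⟨f, hf⟩ := (hL' U' hU').exists_bkaSem_eq_singleton
  obtain ⟨g, hg⟩ := (hK V hV).exists_bkaSem_eq_singleton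
  obtain ⟨k, hk⟩ := (hK' V' hV').exists_bkaSem_eq_singleton
  refine InClosure.step .hole (hH ⟨e, f, g, k, rfl⟩) ?_ _ ?_
  · simp only [bkaSem, he, hf, hg, hk, Lang.seq, Lang.par, Set.image2_singleton,
      Set.mem_singleton_iff, forall_eq, PomCtx.fill]
    exact .base (Set.mem_image2_of_mem (Set.mem_image2_of_mem hU hV)
      (Set.mem_image2_of_mem hU' hV'))
  · simp only [bkaSem, he, hf, hg, hk, Lang.seq, Lang.par, Set.image2_singleton]
    rfl

end Closure

section Semantics

variable {Var : Type u} {Val : Type v}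

/-! ### The observation algebra -/

/-- A smaller state is a more defined one: it extends the larger as a partial function. -/
theorem State.le_iff {α β : State Var Val} :
    α ≤ β ↔ ∀ x n, β.val x = some n → α.val x = some n := by
  constructor
  · rintro h x n hn
    have hx : x ∈ β.dom := by simp [State.dom, hn]
    rw [h.2 x hx, hn]
  · intro h
    have key : ∀ x ∈ β.dom, α.val x = β.val x := by
      intro x hx
      obtain ⟨n, hn⟩ := Option.isSome_iff_exists.1 hx
      rw [hn, h x n hn]
    refine ⟨fun x hx => ?_, key⟩
    change (α.val x).isSome
    rw [key x hx]
    exact hx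

theorem mem_oaAtom {x : Var} {n : Val} {α : State Var Val} :
    α ∈ oaAtom x n ↔ α.val x = some n := Iff.rfl

/-- Binary meets of downwards closed sets distribute over arbitrary unions, so the union defining
`oaNeg Y` is itself disjoint from `Y`. -/
theorem le_oaNeg_iff {Y Z : LowerSet (State Var Val)} : Z ≤ oaNeg Y ↔ Z ⊓ Y = ⊥ := by
  constructor
  · intro h
    rw [← disjoint_iff] at *
    refine Disjoint.mono_left h ?_
    rw [oaNeg, sSup_disjoint_iff]
    intro W hW
    exact (disjoint_iff.2 hW).symm
  · intro h
    exact le_sSup (by rwa [Set.mem_ofPred_eq, inf_comm])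

/-- Kripke-style reading of negation: no refinement of `α` lies in `Y`. It is the adjunction applied
to the principal lower set of `α`. -/
theorem mem_oaNeg {Y : LowerSet (State Var Val)} {α : State Var Val} :
    α ∈ oaNeg Y ↔ ∀ β ≤ α, β ∉ Y := by
  rw [← LowerSet.Iic_le, le_oaNeg_iff, ← disjoint_iff]
  constructor
  · intro h β hβ hY
    have : LowerSet.Iic β ≤ ⊥ := h (LowerSet.Iic_le.2 hβ) (LowerSet.Iic_le.2 hY)
    exact LowerSet.notMem_bot (LowerSet.Iic_le.1 this)
  · intro h W hW hY β hβ
    exact (h β (hW hβ) (hY hβ)).elim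

/-- If `α` is undefined at `x`, setting `x` to `n` refines it to a state satisfying `x = n`. So only
a different, already present value rules this observation out. -/
theorem mem_oaNeg_oaAtom {x : Var} {n : Val} {α : State Var Val} :
    α ∈ oaNeg (oaAtom x n) ↔ ∃ m, m ≠ n ∧ α.val x = some m := by
  classical
  simp only [mem_oaNeg, mem_oaAtom]
  constructor
  · intro h
    cases hx : α.val x with
    | some m => exact ⟨m, fun hmn => h α le_rfl (by rw [hx, hmn]), rfl⟩
    | none =>
      refine (h ⟨Function.update α.val x (some n)⟩ (State.le_iff.2 fun y k hy => ?_)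
        (by simp)).elim
      have hyx : y ≠ x := by
        rintro rfl
        simp [hx] at hy
      rw [← hy]
      exact Function.update_of_ne hyx _ _
  · rintro ⟨m, hmn, hm⟩ β hβ hn
    rw [State.le_iff.1 hβ x m hm] at hn
    exact hmn (Option.some.inj hn)

theorem mem_oaSem_bigOr {l : List (Obs Var Val)} {α : State Var Val} :
    α ∈ oaSem (Obs.bigOr l) ↔ ∃ p ∈ l, α ∈ oaSem p := by
  induction l with
  | nil => simp [Obs.bigOr, oaSem]
  | cons p l ih =>
    rw [List.exists_mem_cons_iff, ← ih]
    exact LowerSet.mem_sup_iff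

theorem mem_oaSem_bigAnd {l : List (Obs Var Val)} {α : State Var Val} :
    α ∈ oaSem (Obs.bigAnd l) ↔ ∀ p ∈ l, α ∈ oaSem p := by
  induction l with
  | nil => simp [Obs.bigAnd, oaSem]
  | cons p l ih =>
    rw [List.forall_mem_cons, ← ih]
    exact LowerSet.mem_inf_iff

theorem oaSem_neg_eq_le (x : Var) (n : Val) (l : List Val) (hl : ∀ m, m ∈ l ↔ m ≠ n) :
    oaSem (¬ₒ(Obs.eq x n)) ≤ oaSem (Obs.bigOr (l.map fun m => Obs.eq x m)) := by
  intro α hα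
  obtain ⟨m, hmn, hm⟩ := mem_oaNeg_oaAtom.1 hα
  exact mem_oaSem_bigOr.2 ⟨_, List.mem_map_of_mem ((hl m).2 hmn), hm⟩

/-- A state compatible with finitely many observations of distinct variables has a refinement
that satisfies them all. -/
theorem State.exists_le_forall_eq_some (α : State Var Val) (l : List (Var × Val))
    (hl : (l.map Prod.fst).Nodup)
    (h : ∀ a ∈ l, ∀ m, α.val a.1 = some m → m = a.2) :
    ∃ β ≤ α, ∀ a ∈ l, β.val a.1 = some a.2 := by
  classical
  induction l with
  | nil => exact ⟨α, le_rfl, by simp⟩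
  | cons a l ih =>
    rw [List.map_cons, List.nodup_cons] at hl
    obtain ⟨β, hβα, hβ⟩ := ih hl.2 fun b hb => h b (List.mem_cons_of_mem a hb)
    -- The new state need not lie below `β`, which may have another value at `a.1`. It lies below
    -- `α`: at `a.1` by compatibility, elsewhere because `β ≤ α`.
    refine ⟨⟨Function.update β.val a.1 (some a.2)⟩, State.le_iff.2 fun y k hy => ?_, ?_⟩
    · by_cases hya : y = a.1
      · subst hya
        rw [h a List.mem_cons_self k hy]
        simp
      · rw [← State.le_iff.1 hβα y k hy]
        exact Function.update_of_ne hya _ _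
    · rw [List.forall_mem_cons]
      refine ⟨by simp, fun b hb => ?_⟩
      rw [← hβ b hb]
      have hba : b.1 ≠ a.1 := fun hba => hl.1 (hba ▸ List.mem_map_of_mem hb)
      exact Function.update_of_ne hba _ _

theorem oaSem_neg_bigAnd_le (l : List (Var × Val)) (hl : (l.map Prod.fst).Nodup) :
    oaSem (¬ₒ(Obs.bigAnd (l.map fun a => Obs.eq a.1 a.2))) ≤
      oaSem (Obs.bigOr (l.map fun a => ¬ₒ(Obs.eq a.1 a.2))) := by
  intro α hα
  -- If `α` refutes none of the observations, it is compatible with all of them, and a common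
  -- refinement contradicts `hα`.
  by_contra hno
  have h : ∀ a ∈ l, ∀ m, α.val a.1 = some m → m = a.2 := by
    intro a ha m hm
    by_contra hma
    exact hno (mem_oaSem_bigOr.2
      ⟨_, List.mem_map_of_mem ha, mem_oaNeg_oaAtom.2 ⟨m, hma, hm⟩⟩)
  obtain ⟨β, hβα, hβ⟩ := α.exists_le_forall_eq_some l hl h
  refine mem_oaNeg.1 hα β hβα (mem_oaSem_bigAnd.2 ?_)
  rw [List.forall_mem_map]
  exact hβ

/-! ### The unclosed semantics -/

/-- The exchange and contraction hypotheses. -/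
abbrev pockaHyp (Var : Type u) (Val : Type v) : Set (Hyp (Letter Var Val)) :=
  exch (Letter Var Val) ∪ contr Var Val

theorem isSP_stateLang (S : Set (State Var Val)) : (stateLang S).IsSP := by
  rintro _ ⟨α, _, rfl⟩
  exact .single _

theorem Lang.IsSP.surround {L : Lang (Letter Var Val)} (hL : L.IsSP) : (surround L).IsSP :=
  ((isSP_stateLang _).star.seq hL).seq (isSP_stateLang _).star

theorem isSP_rawSem (e : Term Var Val) : (rawSem e).IsSP := by
  induction e with
  | zero => exact fun _ h => h.elim
  | one => exact .one
  | letter a =>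
    cases a with
    | inl a => exact (Lang.IsSP.single _).surround
    | inr p => exact (isSP_stateLang _).surround
  | add e f he hf => exact he.union hf
  | seq e f he hf => exact he.seq hf
  | par e f he hf => exact he.par hf
  | star e he => exact he.star

theorem surround_mono {L K : Lang (Letter Var Val)} (h : L ⊆ K) : surround L ⊆ surround K :=
  Lang.seq_mono (Lang.seq_mono subset_rfl h) subset_rfl

theorem surround_union (L K : Lang (Letter Var Val)) :
    surround (L ∪ K) = surround L ∪ surround K := by
  simp only [surround, Lang.seq, Set.image2_union_left, Set.image2_union_right]

theorem surround_empty : surround (∅ : Lang (Letter Var Val)) = ∅ := by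
  simp only [surround, Lang.seq, Set.image2_empty_left, Set.image2_empty_right]

theorem stateLang_empty : stateLang (∅ : Set (State Var Val)) = ∅ := by
  simp [stateLang]

theorem stateLang_mono {S T : Set (State Var Val)} (h : S ⊆ T) : stateLang S ⊆ stateLang T := by
  rintro _ ⟨α, hα, rfl⟩
  exact ⟨α, h hα, rfl⟩

theorem stateLang_union (S T : Set (State Var Val)) :
    stateLang (S ∪ T) = stateLang S ∪ stateLang T := by
  ext U
  simp only [stateLang, Set.mem_ofPred_eq, Set.mem_union, or_and_right, exists_or]

theorem star_seq_surround_subset (L : Lang (Letter Var Val)) :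
    (Lang.star (stateLang Set.univ)).seq (surround L) ⊆ surround L := by
  rw [surround, ← Lang.seq_assoc, ← Lang.seq_assoc]
  exact Lang.seq_mono (Lang.seq_mono (Lang.star_seq_star_subset _) subset_rfl) subset_rfl

theorem surround_seq_star_subset (L : Lang (Letter Var Val)) :
    (surround L).seq (Lang.star (stateLang Set.univ)) ⊆ surround L := by
  rw [surround, Lang.seq_assoc]
  exact Lang.seq_mono subset_rfl (Lang.star_seq_star_subset _)

theorem surround_stateLang_subset_star (S : Set (State Var Val)) :
    surround (stateLang S) ⊆ Lang.star (stateLang Set.univ) :=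
  (Lang.seq_mono (Lang.seq_mono subset_rfl
    ((stateLang_mono (Set.subset_univ S)).trans (Lang.subset_star _))) subset_rfl).trans <|
  (Lang.seq_mono (Lang.star_seq_star_subset _) subset_rfl).trans (Lang.star_seq_star_subset _)

/-- An observation contributes only a sequence of states, which the leading `State*` absorbs. This
and its mirror image give the interface axioms for `⊤`. -/
theorem surround_stateLang_seq_surround_subset (S : Set (State Var Val))
    (L : Lang (Letter Var Val)) : (surround (stateLang S)).seq (surround L) ⊆ surround L :=
  (Lang.seq_mono (surround_stateLang_subset_star S) subset_rfl).trans
    (star_seq_surround_subset L)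

theorem surround_seq_surround_stateLang_subset (S : Set (State Var Val))
    (L : Lang (Letter Var Val)) : (surround L).seq (surround (stateLang S)) ⊆ surround L :=
  (Lang.seq_mono subset_rfl (surround_stateLang_subset_star S)).trans
    (surround_seq_star_subset L)

theorem subset_surround (L : Lang (Letter Var Val)) : L ⊆ surround L := by
  have h := Lang.one_subset_star (stateLang (Set.univ : Set (State Var Val)))
  have := Lang.seq_mono (Lang.seq_mono h (subset_refl L)) h
  rwa [Lang.one_seq, Lang.seq_one] at this

theorem surround_stateLang_inter_subset_closure (S T : Set (State Var Val)) :
    surround (stateLang (S ∩ T)) ⊆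
      closure (pockaHyp Var Val) ((surround (stateLang S)).seq (surround (stateLang T))) := by
  -- The two inner `State*` factors on the right are taken to be empty.
  have hsub : surround ((stateLang S).seq (stateLang T)) ⊆
      (surround (stateLang S)).seq (surround (stateLang T)) := by
    have h : surround ((stateLang S).seq (stateLang T)) =
        ((Lang.star (stateLang Set.univ)).seq (stateLang S)).seq
          ((stateLang T).seq (Lang.star (stateLang Set.univ))) := by
      simp only [surround, Lang.seq_assoc]
    rw [h]
    have h1 := Lang.one_subset_star (stateLang (Set.univ : Set (State Var Val)))
    refine Lang.seq_mono ?_ ?_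
    · rw [surround]
      simpa only [Lang.seq_one] using
        Lang.seq_mono (subset_refl ((Lang.star (stateLang Set.univ)).seq (stateLang S))) h1
    · rw [surround, Lang.seq_assoc]
      simpa only [Lang.one_seq] using Lang.seq_mono h1
        (subset_refl ((stateLang T).seq (Lang.star (stateLang Set.univ))))
  refine Set.Subset.trans ?_ (closure_mono hsub)
  have hstar := (isSP_stateLang (Set.univ : Set (State Var Val))).star
  have hST := (isSP_stateLang S).seq (isSP_stateLang T)
  refine seq_subset_closure_seq (hstar.seq hST) hstar
    (seq_subset_closure_seq hstar hST subset_closure ?_) subset_closure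
  rintro _ ⟨α, ⟨hS, hT⟩, rfl⟩
  -- Contraction: `α` is obtained from `α · α`, with one copy read in `S` and the other in `T`.
  refine InClosure.step .hole (Or.inr ⟨α, rfl⟩) ?_ _ (Set.mem_singleton _)
  rintro _ ⟨_, rfl, _, rfl, rfl⟩
  exact .base (Set.mem_image2_of_mem ⟨α, hS, rfl⟩ ⟨α, hT, rfl⟩)

/-! ### Observations are determined by their closed semantics -/

/-- Having a label in `S` is invariant under closure: for both kinds of hypotheses, each pomset on
the left has the same label set as some pomset on the right, and contexts respect this. -/
theorem exists_mem_labels_of_mem_closure {S : Set (State Var Val)} {U : Pom (Letter Var Val)}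
    (hU : U ∈ closure (pockaHyp Var Val) (surround (stateLang S))) :
    ∃ α ∈ S, Sum.inr α ∈ U.labels := by
  induction hU with
  | base hU =>
    obtain ⟨_, ⟨V, _, _, ⟨α, hα, rfl⟩, rfl⟩, W, _, rfl⟩ := hU
    exact ⟨α, hα, by simp [Pom.labels_seq, Pom.labels_single]⟩
  | step C hef _ U hU ih =>
    rcases hef with ⟨e, f, g, k, h⟩ | ⟨α, h⟩
    · obtain ⟨rfl, rfl⟩ := Prod.mk.inj h
      obtain ⟨_, ⟨V, hV, V', hV', rfl⟩, _, ⟨W, hW, W', hW', rfl⟩, rfl⟩ := hU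
      have hlab : ((V.seq W).par (V'.seq W')).labels = ((V.par V').seq (W.par W')).labels := by
        simp only [Pom.labels_seq, Pom.labels_par, Set.union_union_union_comm]
      rw [← C.labels_fill hlab]
      -- The premise of the step covers all pomsets on the right; the one regrouping the same four
      -- factors suffices.
      exact ih _ (Set.mem_image2_of_mem (Set.mem_image2_of_mem hV hW)
        (Set.mem_image2_of_mem hV' hW'))
    · obtain ⟨rfl, rfl⟩ := Prod.mk.inj h
      obtain rfl : U = Pom.single (Sum.inr α) := hU
      have hlab : ((Pom.single (Sum.inr α)).seq (Pom.single (Sum.inr α))).labels =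
          (Pom.single (Sum.inr α : Letter Var Val)).labels := by
        rw [Pom.labels_seq, Set.union_self]
      rw [← C.labels_fill hlab]
      exact ih _ (Set.mem_image2_of_mem rfl rfl)

/-- For `α` in the set denoted by `p`, the one-event pomset `α` lies in the closure for `q`. Its
only label is `α`, so the label invariant forces `α` into the set denoted by `q`. -/
theorem rawSem_obs_subset_closure_iff {p q : Obs Var Val} :
    rawSem (Term.obs p) ⊆ closure (pockaHyp Var Val) (rawSem (Term.obs q)) ↔
      oaSem p ≤ oaSem q := by
  constructor
  · intro h α hα
    obtain ⟨β, hβ, hl⟩ := exists_mem_labels_of_mem_closure (h (subset_surround _ ⟨α, hα, rfl⟩))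
    rw [Pom.labels_single, Set.mem_singleton_iff] at hl
    exact Sum.inr.inj hl ▸ hβ
  · intro h
    exact (surround_mono (stateLang_mono h)).trans subset_closure

theorem pockaSem_add_eq_right_iff {e f : Term Var Val} :
    pockaSem (e +ₜ f) = pockaSem f ↔ rawSem e ⊆ pockaSem f :=
  closure_union_eq_right_iff

theorem pockaSem_eq_of_rawSem_eq {e f : Term Var Val} (h : rawSem e = rawSem f) :
    pockaSem e = pockaSem f := by
  rw [pockaSem, pockaSem, h]

theorem rawSem_subset_of_pockaSem_eq {e f : Term Var Val} (h : pockaSem e = pockaSem f) :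
    rawSem e ⊆ pockaSem f :=
  h ▸ subset_closure

theorem pockaSem_eq_of_subset {e f : Term Var Val} (h : rawSem e ⊆ pockaSem f)
    (k : rawSem f ⊆ pockaSem e) : pockaSem e = pockaSem f :=
  (closure_subset_of_subset_closure h).antisymm (closure_subset_of_subset_closure k)

theorem pockaSem_obs_eq_iff {p q : Obs Var Val} :
    pockaSem (Term.obs p) = pockaSem (Term.obs q) ↔ oaSem p = oaSem q := by
  constructor
  · intro h
    exact (rawSem_obs_subset_closure_iff.1 (rawSem_subset_of_pockaSem_eq h)).antisymm
      (rawSem_obs_subset_closure_iff.1 (rawSem_subset_of_pockaSem_eq h.symm))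
  · intro h
    simp only [pockaSem, rawSem, h]

theorem pockaSem_obs_add_obs_eq_right_iff {p q : Obs Var Val} :
    pockaSem (Term.obs p +ₜ Term.obs q) = pockaSem (Term.obs q) ↔ oaSem p ≤ oaSem q :=
  pockaSem_add_eq_right_iff.trans rawSem_obs_subset_closure_iff

/-! ### Congruence of the closed semantics -/

theorem pockaSem_add_congr {e e' f f' : Term Var Val} (h : pockaSem e = pockaSem e')
    (k : pockaSem f = pockaSem f') : pockaSem (e +ₜ f) = pockaSem (e' +ₜ f') := by
  have key : ∀ {e e' f f' : Term Var Val}, pockaSem e = pockaSem e' → pockaSem f = pockaSem f' →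
      rawSem (e +ₜ f) ⊆ pockaSem (e' +ₜ f') := fun h k =>
    Set.union_subset
      ((rawSem_subset_of_pockaSem_eq h).trans (closure_mono Set.subset_union_left))
      ((rawSem_subset_of_pockaSem_eq k).trans (closure_mono Set.subset_union_right))
  exact pockaSem_eq_of_subset (key h k) (key h.symm k.symm)

theorem pockaSem_seq_congr {e e' f f' : Term Var Val} (h : pockaSem e = pockaSem e')
    (k : pockaSem f = pockaSem f') : pockaSem (e ⬝ₜ f) = pockaSem (e' ⬝ₜ f') :=
  pockaSem_eq_of_subset
    (seq_subset_closure_seq (isSP_rawSem e') (isSP_rawSem f') (rawSem_subset_of_pockaSem_eq h)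
      (rawSem_subset_of_pockaSem_eq k))
    (seq_subset_closure_seq (isSP_rawSem e) (isSP_rawSem f)
      (rawSem_subset_of_pockaSem_eq h.symm) (rawSem_subset_of_pockaSem_eq k.symm))

theorem pockaSem_par_congr {e e' f f' : Term Var Val} (h : pockaSem e = pockaSem e')
    (k : pockaSem f = pockaSem f') : pockaSem (e ∥ₜ f) = pockaSem (e' ∥ₜ f') :=
  pockaSem_eq_of_subset
    (par_subset_closure_par (isSP_rawSem e') (isSP_rawSem f') (rawSem_subset_of_pockaSem_eq h)
      (rawSem_subset_of_pockaSem_eq k))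
    (par_subset_closure_par (isSP_rawSem e) (isSP_rawSem f)
      (rawSem_subset_of_pockaSem_eq h.symm) (rawSem_subset_of_pockaSem_eq k.symm))

theorem pockaSem_star_congr {e e' : Term Var Val} (h : pockaSem e = pockaSem e') :
    pockaSem e⋆ₜ = pockaSem e'⋆ₜ :=
  pockaSem_eq_of_subset
    (star_subset_closure_star (isSP_rawSem e') (rawSem_subset_of_pockaSem_eq h))
    (star_subset_closure_star (isSP_rawSem e) (rawSem_subset_of_pockaSem_eq h.symm))

/-! ### Soundness -/

theorem ProvEquiv.pockaSem_eq {e f : Term Var Val} (h : ProvEquiv e f) :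
    pockaSem e = pockaSem f := by
  induction h with
  | refl e => rfl
  | symm _ ih => exact ih.symm
  | trans _ _ ih ih' => exact ih.trans ih'
  | add_congr _ _ ih ih' => exact pockaSem_add_congr ih ih'
  | seq_congr _ _ ih ih' => exact pockaSem_seq_congr ih ih'
  | par_congr _ _ ih ih' => exact pockaSem_par_congr ih ih'
  | star_congr _ ih => exact pockaSem_star_congr ih
  | or_congr _ _ ih ih' =>
    rw [pockaSem_obs_eq_iff] at *
    simp only [oaSem, ih, ih']
  | and_congr _ _ ih ih' =>
    rw [pockaSem_obs_eq_iff] at *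
    simp only [oaSem, ih, ih']
  | neg_congr _ ih =>
    rw [pockaSem_obs_eq_iff] at *
    simp only [oaSem, ih]
  | add_assoc e f g => exact pockaSem_eq_of_rawSem_eq (Set.union_assoc _ _ _).symm
  | add_comm e f => exact pockaSem_eq_of_rawSem_eq (Set.union_comm _ _)
  | add_zero e => exact pockaSem_eq_of_rawSem_eq (Set.union_empty _)
  | add_idem e => exact pockaSem_eq_of_rawSem_eq (Set.union_self _)
  | seq_assoc e f g => exact pockaSem_eq_of_rawSem_eq (Lang.seq_assoc _ _ _).symm
  | seq_one e => exact pockaSem_eq_of_rawSem_eq (Lang.seq_one _)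
  | one_seq e => exact pockaSem_eq_of_rawSem_eq (Lang.one_seq _)
  | seq_zero e => exact pockaSem_eq_of_rawSem_eq Set.image2_empty_right
  | zero_seq e => exact pockaSem_eq_of_rawSem_eq Set.image2_empty_left
  | seq_add e f g => exact pockaSem_eq_of_rawSem_eq Set.image2_union_right
  | add_seq e f g => exact pockaSem_eq_of_rawSem_eq Set.image2_union_left
  | star_unfold_left e => exact pockaSem_eq_of_rawSem_eq (Lang.star_unfold_left _)
  | star_unfold_right e => exact pockaSem_eq_of_rawSem_eq (Lang.star_unfold_right _)
  | @star_induct_right e f g _ ih =>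
    rw [pockaSem_add_eq_right_iff] at *
    -- The inclusion `ih` of the union splits into the base case and the invariance needed for
    -- induction on powers.
    exact seq_star_subset_closure (isSP_rawSem f) (isSP_rawSem g)
      (Set.subset_union_left.trans ih) (Set.subset_union_right.trans ih)
  | @star_induct_left e f g _ ih =>
    rw [pockaSem_add_eq_right_iff] at *
    exact star_seq_subset_closure (isSP_rawSem g) (isSP_rawSem f)
      (Set.subset_union_left.trans ih) (Set.subset_union_right.trans ih)
  | par_one e =>
    refine pockaSem_eq_of_rawSem_eq ?_
    simp [rawSem, Lang.par, Pom.par_one]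
  | par_assoc e f g => exact pockaSem_eq_of_rawSem_eq (Set.image2_assoc Pom.par_assoc).symm
  | par_zero e => exact pockaSem_eq_of_rawSem_eq Set.image2_empty_right
  | par_add e f g => exact pockaSem_eq_of_rawSem_eq Set.image2_union_right
  | par_comm e f => exact pockaSem_eq_of_rawSem_eq (Set.image2_comm Pom.par_comm)
  | exchange e f g h =>
    exact pockaSem_add_eq_right_iff.2 (exchange_subset_closure Set.subset_union_left
      (isSP_rawSem e) (isSP_rawSem f) (isSP_rawSem g) (isSP_rawSem h))
  | or_bot p => exact pockaSem_obs_eq_iff.2 (sup_bot_eq _)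
  | and_top p => exact pockaSem_obs_eq_iff.2 (inf_top_eq _)
  | or_comm p q => exact pockaSem_obs_eq_iff.2 (sup_comm _ _)
  | and_comm p q => exact pockaSem_obs_eq_iff.2 (inf_comm _ _)
  | and_assoc p q r => exact pockaSem_obs_eq_iff.2 (inf_assoc _ _ _).symm
  | or_assoc p q r => exact pockaSem_obs_eq_iff.2 (sup_assoc _ _ _).symm
  | or_absorb p q => exact pockaSem_obs_eq_iff.2 sup_inf_self
  | and_absorb p q => exact pockaSem_obs_eq_iff.2 inf_sup_self
  | or_and p q r => exact pockaSem_obs_eq_iff.2 (sup_inf_left _ _ _)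
  | and_or p q r => exact pockaSem_obs_eq_iff.2 (inf_sup_left _ _ _)
  | neg_elim _ ih =>
    exact pockaSem_obs_eq_iff.2 (le_oaNeg_iff.1 (pockaSem_obs_add_obs_eq_right_iff.1 ih))
  | neg_intro _ ih =>
    exact pockaSem_obs_add_obs_eq_right_iff.2 (le_oaNeg_iff.2 (pockaSem_obs_eq_iff.1 ih))
  | eq_and_eq x hnm =>
    refine pockaSem_obs_eq_iff.2 (le_bot_iff.1 fun α hα => ?_)
    -- A state assigns at most one value to `x`.
    exact (hnm (Option.some.inj (hα.1.symm.trans hα.2))).elim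
  | neg_eq x n l hl => exact pockaSem_obs_add_obs_eq_right_iff.2 (oaSem_neg_eq_le x n l hl)
  | neg_and l hl => exact pockaSem_obs_add_obs_eq_right_iff.2 (oaSem_neg_bigAnd_le l hl)
  | and_le_seq p q =>
    exact pockaSem_add_eq_right_iff.2 (surround_stateLang_inter_subset_closure _ _)
  | or_eq_add p q =>
    refine pockaSem_eq_of_rawSem_eq ?_
    simp only [rawSem, oaSem, LowerSet.coe_sup, stateLang_union, surround_union]
  | zero_eq_bot =>
    refine pockaSem_eq_of_rawSem_eq ?_
    simp only [rawSem, oaSem, LowerSet.coe_bot, stateLang_empty, surround_empty]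
  | top_seq_obs p =>
    exact pockaSem_add_eq_right_iff.2
      ((surround_stateLang_seq_surround_subset _ _).trans subset_closure)
  | obs_seq_top p =>
    exact pockaSem_add_eq_right_iff.2
      ((surround_seq_surround_stateLang_subset _ _).trans subset_closure)
  | top_seq_act a =>
    exact pockaSem_add_eq_right_iff.2
      ((surround_stateLang_seq_surround_subset _ _).trans subset_closure)
  | act_seq_top a =>
    exact pockaSem_add_eq_right_iff.2
      ((surround_seq_surround_stateLang_subset _ _).trans subset_closure)

end Semantics

end POCKA

theorem mainTheorem2 {Var : Type*} {Val : Type*} [Finite Var] [Finite Val]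
    (e f : POCKA.Term Var Val) (h : POCKA.ProvEquiv e f) :
    POCKA.pockaSem e = POCKA.pockaSem f :=
  h.pockaSem_eq
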